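/- For an integer $N\ge 3$, let $B_{\bar N}$ be the (possibly finite) integer sequence with $B_{\bar N}(n)=0$ for all $n\le 0$, $B_{\bar N}(n)=n$ for $1\le n\le N$, and, for $n>N$, \[ B_{\bar N}(n)=B_{\bar N}\bigl(n-B_{\bar N}(n-1)\bigr)+B_{\bar N}\bigl(n-B_{\bar N}(n-2)\bigr)+B_{\bar N}\bigl(n-B_{\bar N}(n-3)\bigr), \] as long as the preceding term $B_{\bar N}(n-1)$ is positive. If $T>N$ is the first index with $B_{\bar N}(T)\le 0$, then $B_{\bar N}(T+1)$ and all later terms are undefined, and we say that $B_{\bar N}$ ends after (exactly) $T$ terms. Let $N\ge 72$ be a natural number. Then the following period-$7$ pattern begins at index $N+67$ in $B_{\bar N}$, where $k$ denotes a positive integer: \[ \begin{cases} B_{\bar N}(N+7k)=7k+2\\ B_{\bar N}(N+7k+1)=N+7k+2\\ B_{\bar N}(N+7k+2)=N+7k+4\\ B_{\bar N}(N+7k+3)=7\\ B_{\bar N}(N+7k+4)=2N+2k+45\\ B_{\bar N}(N+7k+5)=2N+k-7\\ B_{\bar N}(N+7k+6)=N-2. \end{cases} \] This pattern lasts through index $2N+\nu$,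 where $\nu=-1,-2,-2,-2,2,1,0$ according to $N\equiv 0,1,2,3,4,5,6\pmod 7$. That is, all terms with indices from $N+67$ through $2N+\nu$ exist and are given by the pattern, while neither at index $N+66$ nor at index $2N+\nu+1$ does the sequence have the term that the pattern prescribes. After this, \begin{itemize} \item if $N\equiv 0\pmod 7$ and $N\ge 196$, then $B_{\bar N}$ ends after $2N+27$ terms; \item if $N\equiv 1\pmod 7$ and $N\ge 2087$, then $B_{\bar N}$ ends after $2N+254$ terms; \item if $N\equiv 2\pmod 7$ and $N\ge 3201$, then $B_{\bar N}$ ends after $2N+524$ terms; \item if $N\equiv 3\pmod 7$ and $N\ge 4315$, then $B_{\bar N}$ ends after $2N+560$ terms; \item if $N\equiv 4\pmod 7$ and $N\ge 200$, then $B_{\bar N}$ ends after $2N+20$ terms; \item if $N\equiv 5\pmod 7$ and $N\ge 32478$, then $B_{\bar N}$ ends after $2N+4547$ terms; \item if $N\equiv 6\pmod 7$ and $N\ge 118$, then $B_{\bar N}$ ends after $2N+9$ terms. \end{itemize} -/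

import Mathlib

namespace HofstadterB

/-- One step of the recurrence `B(n) = B(n - B(n-1)) + B(n - B(n-2)) + B(n - B(n-3))`, for a
partial sequence `B` (`none` means that there is no term at that index). The new term is undefined
if one of the three preceding terms is missing or is not positive (the recurrence would then refer
to an index that is not smaller than `n`), or if a term that the recurrence refers to is missing. -/
def nextTerm (B : ℤ → Option ℤ) (n : ℤ) : Option ℤ :=
  (B (n - 1)).bind fun a =>
  (B (n - 2)).bind fun b =>
  (B (n - 3)).bind fun c =>
    if 0 < a ∧ 0 < b ∧ 0 < c then
      (B (n - a)).bind fun x =>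
      (B (n - b)).bind fun y =>
      (B (n - c)).bind fun z => some (x + y + z)
    else none

/-- The sequence after `t` steps of the recurrence, starting from initial conditions `init n`
at all integer indices `n ≤ m`. -/
def stage (init : ℤ → ℤ) (m : ℕ) : ℕ → ℤ → Option ℤ
  | 0 => fun n => if n ≤ (m : ℤ) then some (init n) else none
  | t + 1 => fun n =>
      if n = (m : ℤ) + (t : ℤ) + 1 then nextTerm (stage init m t) n else stage init m t n

/-- The (partial) sequence that the recurrence generates from the initial conditions `init n`
for all integers `n ≤ m`. The term at the index `m + t`, where `t ≥ 1`, is produced in step `t`. -/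
def genSeq (init : ℤ → ℤ) (m : ℕ) (n : ℤ) : Option ℤ :=
  stage init m (n - (m : ℤ)).toNat n

/-- The sequence with initial conditions `⟨0̄; 1, 2, …, N⟩`: its term is `0` at each nonpositive
index, and `n` at each index `1 ≤ n ≤ N`. -/
def Bbar (N : ℕ) : ℤ → Option ℤ :=
  genSeq (fun n => if n ≤ 0 then 0 else n) N

/-- The sequence `B` ends after exactly `T` terms `B(1), …, B(T)`: all terms up to the index `T`
exist, the last one is not positive, and there are no further terms. -/
def EndsAfter (B : ℤ → Option ℤ) (T : ℤ) : Prop :=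
  (∀ n : ℤ, n ≤ T → (B n).isSome) ∧ (∃ v : ℤ, v ≤ 0 ∧ B T = some v) ∧ ∀ n : ℤ, T < n → B n = none

/-- The value that the period-7 pattern prescribes at the index `N + 7 * k + r`. -/
def patternTerm (N : ℕ) (k : ℤ) : Fin 7 → ℤ :=
  ![7 * k + 2,
    N + 7 * k + 2,
    N + 7 * k + 4,
    7,
    2 * N + 2 * k + 45,
    2 * N + k - 7,
    N - 2]

/-- At the index `n`, the sequence `Bbar N` has a term, and it is the one prescribed by the
pattern. -/
def FollowsPatternAt (N : ℕ) (n : ℤ) : Prop :=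
  ∃ k : ℤ, 1 ≤ k ∧ ∃ r : Fin 7,
    n = N + 7 * k + ((r : ℕ) : ℤ) ∧ Bbar N n = some (patternTerm N k r)

/-- The number `ν`: the pattern lasts through the index `2 * N + ν`. -/
def nu (N : ℕ) : ℤ :=
  match N % 7 with
  | 0 => -1
  | 1 => -2
  | 2 => -2
  | 3 => -2
  | 4 => 2
  | 5 => 1
  | _ => 0

end HofstadterB

/-!
The terms of `Bbar N` are nonnegative, and for all large `N` in a fixed residue class modulo 7 each
term at a bounded distance from `N` or from `2 * N` is an affine function of `N`. So the recurrence
can be run symbolically, for all these `N` at once: a reference `n - B` is either nonpositive (the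
term there is `0`), or lies among the initial terms (the term there is the index), or hits an
earlier term that is known as an affine function. Such a run is a finite computation (`step`,
`refer`), and `valid_step` says that it computes the terms of the sequence.

Three facts make up the theorem.
* With `N = 72 + t`, the symbolic run from the index `N` gives the terms up to `N + 69`
  (`Bbar_transient`). The last three of them are the first terms of the pattern.
* From there on the pattern reproduces itself (`Bbar_pattern`): in each of the seven positions, the
  three references go to nonpositive indices, to initial terms, to the term `6` at `N + 1`, or to
  the pattern seven indices earlier. This breaks as soon as the reference to the initial term
  `7 * k + 2`, `7 * k + 3` or `7 * k + 4` passes `N`, which determines `nu N`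
  (`not_followsPatternAt_nu_add_one`).
* Let `M` be the bound on `N` that the theorem asks for in a residue class; it lies in that class,
  so `N = 7 * t + M`. The symbolic run in the parameter `t` from the end of the pattern
  (`endCheck`), which uses all that is known about earlier terms, arrives at a term that is `0` for
  all `t` (`endsAfter_of_endCheck`).

The terms of a run are stored in the 40-bit blocks of a single natural number, so that the kernel
evaluates the longest run, of over 4500 steps, with its built-in arithmetic.
-/

namespace HofstadterB

/-! ### The recurrence -/

lemma nextTerm_congr {B B' : ℤ → Option ℤ} {n : ℤ} (h : ∀ k < n, B k = B' k) :
    nextTerm B n = nextTerm B' n := by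
  unfold nextTerm
  rw [h (n - 1) (by omega), h (n - 2) (by omega), h (n - 3) (by omega)]
  refine Option.bind_congr fun a _ => Option.bind_congr fun b _ => Option.bind_congr fun c _ => ?_
  split_ifs with hp
  · rw [h (n - a) (by omega), h (n - b) (by omega), h (n - c) (by omega)]
  · rfl

/-- Once the construction has passed the index `n`, later stages leave the term there unchanged. -/
lemma stage_eq_genSeq (init : ℤ → ℤ) (m t : ℕ) (n : ℤ) (h : n ≤ m + t) :
    stage init m t n = genSeq init m n := by
  induction t with
  | zero => simp [genSeq, show (n - m).toNat = 0 by omega]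
  | succ t ih =>
    rcases eq_or_ne n (m + t + 1) with hn | hn
    · rw [genSeq, show (n - m).toNat = t + 1 by omega]
    · exact (if_neg hn).trans (ih (by push_cast at h; omega))

lemma Bbar_of_le {N : ℕ} {n : ℤ} (h : n ≤ N) :
    Bbar N n = some (if n ≤ 0 then 0 else n) := by
  rw [Bbar, ← stage_eq_genSeq _ _ 0 _ (by simpa using h)]
  exact if_pos h

lemma Bbar_of_nonpos {N : ℕ} {n : ℤ} (h : n ≤ 0) : Bbar N n = some 0 := by
  rw [Bbar_of_le (by omega), if_pos h]

lemma Bbar_of_mem {N : ℕ} {n : ℤ} (h0 : 0 ≤ n) (h : n ≤ N) : Bbar N n = some n := by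
  rw [Bbar_of_le h]
  split_ifs
  · simp; omega
  · rfl

lemma Bbar_of_lt {N : ℕ} {n : ℤ} (h : (N : ℤ) < n) : Bbar N n = nextTerm (Bbar N) n := by
  obtain ⟨t, rfl⟩ : ∃ t : ℕ, n = N + t + 1 := ⟨(n - N - 1).toNat, by omega⟩
  rw [Bbar, ← stage_eq_genSeq _ _ (t + 1) _ (by push_cast; omega)]
  exact (if_pos rfl).trans (nextTerm_congr fun k hk => stage_eq_genSeq _ _ _ _ (by omega))

lemma Bbar_step {N : ℕ} {n a b c x y z : ℤ} (hn : (N : ℤ) < n)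
    (h1 : Bbar N (n - 1) = some a) (h2 : Bbar N (n - 2) = some b) (h3 : Bbar N (n - 3) = some c)
    (ha : 0 < a) (hb : 0 < b) (hc : 0 < c)
    (hx : Bbar N (n - a) = some x) (hy : Bbar N (n - b) = some y) (hz : Bbar N (n - c) = some z) :
    Bbar N n = some (x + y + z) := by
  simp [Bbar_of_lt hn, nextTerm, h1, h2, h3, ha, hb, hc, hx, hy, hz]

/-- A term that is not positive ends the sequence. -/
lemma Bbar_eq_none {N : ℕ} {T v n : ℤ} (hT : (N : ℤ) ≤ T) (hv : Bbar N T = some v) (hv0 : v ≤ 0)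
    (hn : T < n) : Bbar N n = none := by
  obtain ⟨j, rfl⟩ : ∃ j : ℕ, n = T + 1 + j := ⟨(n - T - 1).toNat, by omega⟩
  induction j with
  | zero =>
    rw [Bbar_of_lt (by omega), nextTerm]
    simp [hv, hv0.not_gt]
  | succ j ih =>
    rw [Bbar_of_lt (by push_cast; omega), nextTerm,
      show T + 1 + ((j + 1 : ℕ) : ℤ) - 1 = T + 1 + j by push_cast; ring, ih (by omega)]
    rfl

/-! ### Affine functions coded by natural numbers -/

/-- The code of the affine function `t ↦ a * t + b`, where `b < 2 ^ 28`. -/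
def pack (a b : ℕ) : ℕ := a * 2 ^ 28 + b

/-- The coefficient of `t` in the affine function with code `c`. -/
def slope (c : ℕ) : ℕ := c / 2 ^ 28

/-- The value at `t = 0` of the affine function with code `c`. -/
def offset (c : ℕ) : ℕ := c % 2 ^ 28

/-- The value at `t` of the affine function with code `c`. -/
def val (c t : ℕ) : ℕ := slope c * t + offset c

lemma val_pack {a b : ℕ} (h : b < 2 ^ 28) (t : ℕ) : val (pack a b) t = a * t + b := by
  have h1 : slope (pack a b) = a := by unfold slope pack; omega
  have h2 : offset (pack a b) = b := by unfold offset pack; omega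
  rw [val, h1, h2]

lemma val_add {x y z : ℕ} (h : offset x + offset y + offset z < 2 ^ 28) (t : ℕ) :
    val (x + y + z) t = val x t + val y t + val z t := by
  unfold offset at h
  have h1 : slope (x + y + z) = slope x + slope y + slope z := by unfold slope; omega
  have h2 : offset (x + y + z) = offset x + offset y + offset z := by unfold offset; omega
  rw [val, h1, h2]
  unfold val
  ring

/-- The `d`-th block of 40 bits of `mem`, counted from the low end. -/
def entry (mem d : ℕ) : ℕ := (mem >>> (40 * d)) % 2 ^ 40

lemma entry_push_zero {mem c : ℕ} (h : c < 2 ^ 40) : entry (mem * 2 ^ 40 + c) 0 = c := by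
  simp [entry]; omega

lemma entry_push_succ {mem c : ℕ} (h : c < 2 ^ 40) (d : ℕ) :
    entry (mem * 2 ^ 40 + c) (d + 1) = entry mem d := by
  rw [entry, entry, Nat.shiftRight_eq_div_pow, Nat.shiftRight_eq_div_pow, mul_add, mul_one,
    add_comm (40 * d), pow_add, ← Nat.div_div_eq_div_mul]
  congr 2
  omega

/-! ### Symbolic execution of the recurrence -/

/-- `force n f = f n`; the recursion makes the kernel evaluate `n` to a numeral before it enters
`f`. -/
def force {α : Type} (n : ℕ) (f : ℕ → α) : α := Nat.rec (f 0) (fun k _ => f (k + 1)) n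

@[simp] lemma force_eq {α : Type} (n : ℕ) (f : ℕ → α) : force n f = f n := by
  cases n <;> rfl

/-- The code of the term at the index `A * t + n - v`, where `v` has the code `c`, if it can be
found. The terms with indices from `A * t + C` to `A * t + n - 1` are stored in `mem`, the last one
in the lowest block, and `look α β` supplies the code of the term at the index `α * t + β` for
smaller indices. -/
def refer (A C : ℕ) (look : ℕ → ℕ → Option ℕ) (n mem c : ℕ) : Option ℕ :=
  if A ≤ slope c ∧ n ≤ offset c then some 0
  else if slope c ≤ A ∧ offset c ≤ n then
    if slope c = 0 ∧ C ≤ n - offset c then some (entry mem (offset c - 1))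
    else look (A - slope c) (n - offset c)
  else none

/-- One step of the recurrence, carried out for all `t` at once, on a state `(n, mem)` as in
`refer`. A state in which the last term vanishes is left alone. -/
def step (A C : ℕ) (look : ℕ → ℕ → Option ℕ) (s : ℕ × ℕ) : Option (ℕ × ℕ) :=
  force (s.2 % 2 ^ 120) fun top =>
    force (entry top 0) fun a => force (entry top 1) fun b => force (entry top 2) fun c =>
      if a = 0 then some s
      else if 0 < offset a ∧ 0 < offset b ∧ 0 < offset c then
        (refer A C look s.1 s.2 a).bind fun x =>
        (refer A C look s.1 s.2 b).bind fun y =>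
        (refer A C look s.1 s.2 c).bind fun z =>
          if offset x + offset y + offset z < 2 ^ 28 ∧ x + y + z < 2 ^ 40 then
            force (s.1 + 1) fun n => force (s.2 * 2 ^ 40 + (x + y + z)) fun mem => some (n, mem)
          else none
      else none

/-- The `n`-fold iterate of a partial function. -/
def iter {σ : Type} (f : σ → Option σ) : ℕ → σ → Option σ
  | 0, s => some s
  | n + 1, s => (f s).bind (iter f n)

lemma iter_induction {σ : Type} {f : σ → Option σ} {P : σ → Prop}
    (hf : ∀ s s', P s → f s = some s' → P s') (n : ℕ) (s s' : σ) (hs : P s)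
    (h : iter f n s = some s') : P s' := by
  induction n generalizing s with
  | zero => cases h; exact hs
  | succ n ih =>
    obtain ⟨u, hu, h⟩ := Option.bind_eq_some_iff.1 h
    exact ih u (hf s u hs hu) h

/-- At the parameter `t`, the blocks of `s.2` hold the terms of `Bbar N` with indices from
`A * t + C` to `A * t + s.1 - 1`, of which there are at least three. -/
def Valid (N A C t : ℕ) (s : ℕ × ℕ) : Prop :=
  C + 3 ≤ s.1 ∧ ∀ d : ℕ, C + d < s.1 →
    Bbar N ((A : ℤ) * t + s.1 - 1 - d) = some (val (entry s.2 d) t : ℤ)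

/-- The function `look` gives correct terms of `Bbar N` at the parameter `t`. -/
def Correct (N t : ℕ) (look : ℕ → ℕ → Option ℕ) : Prop :=
  ∀ α β c : ℕ, look α β = some c → Bbar N ((α : ℤ) * t + β) = some (val c t : ℤ)

section

variable {N A C t : ℕ} {look : ℕ → ℕ → Option ℕ}

lemma Bbar_refer (hlook : Correct N t look) {s : ℕ × ℕ} (hs : Valid N A C t s) {c x : ℕ}
    (hc : 0 < offset c) (h : refer A C look s.1 s.2 c = some x) :
    Bbar N ((A : ℤ) * t + s.1 - val c t) = some (val x t : ℤ) := by
  unfold refer at h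
  split_ifs at h with h1 h2 h3
  · cases h
    have : A * t + s.1 ≤ val c t := add_le_add (Nat.mul_le_mul_right _ h1.1) h1.2
    rw [Bbar_of_nonpos (by zify at this; linarith)]
    simp [val, slope, offset]
  · cases h
    have := hs.2 (offset c - 1) (by omega)
    rw [← this, val, h3.1]
    congr 1
    push_cast [hc]
    omega
  · rw [← hlook _ _ _ h, val]
    congr 1
    push_cast [h2.1, h2.2]
    ring

/-- Soundness of the symbolic execution: the term that `step` appends is a term of `Bbar N`. -/
lemma valid_step (hN : N < A * t + C + 3) (hlook : Correct N t look) (s s' : ℕ × ℕ)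
    (hs : Valid N A C t s) (h : step A C look s = some s') : Valid N A C t s' := by
  -- `step` reads the last three terms from a truncation of the memory
  have hmod : ∀ d < 3, entry (s.2 % 2 ^ 120) d = entry s.2 d := by
    intro d hd
    unfold entry
    interval_cases d <;> simp [Nat.shiftRight_eq_div_pow] <;> omega
  simp only [step, force_eq, hmod 0 (by omega), hmod 1 (by omega), hmod 2 (by omega)] at h
  split_ifs at h with h0 hpos
  · cases h; exact hs
  obtain ⟨x, hx, h⟩ := Option.bind_eq_some_iff.1 h
  obtain ⟨y, hy, h⟩ := Option.bind_eq_some_iff.1 h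
  obtain ⟨z, hz, h⟩ := Option.bind_eq_some_iff.1 h
  split_ifs at h with hlt
  cases h
  have hC := hs.1
  have pos : ∀ c, 0 < offset c → (0 : ℤ) < (val c t : ℤ) := fun c hc => by
    have := Nat.le_add_left (offset c) (slope c * t)
    unfold val; omega
  have key : Bbar N ((A : ℤ) * t + s.1) = some (val (x + y + z) t : ℤ) := by
    rw [val_add hlt.1]
    push_cast
    refine Bbar_step (by zify at hN hC; linarith) ?_ ?_ ?_ (pos _ hpos.1) (pos _ hpos.2.1)
      (pos _ hpos.2.2) (Bbar_refer hlook hs hpos.1 hx) (Bbar_refer hlook hs hpos.2.1 hy)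
      (Bbar_refer hlook hs hpos.2.2 hz)
    · simpa using hs.2 0 (by omega)
    · rw [← hs.2 1 (by omega)]; congr 1; push_cast; ring
    · rw [← hs.2 2 (by omega)]; congr 1; push_cast; ring
  refine ⟨by dsimp only; omega, fun d hd => ?_⟩
  cases d with
  | zero =>
    rw [entry_push_zero hlt.2, ← key]
    congr 1; push_cast; ring
  | succ d =>
    rw [entry_push_succ hlt.2, ← hs.2 d (by dsimp only at hd; omega)]
    congr 1; push_cast; ring

lemma valid_iter (hN : N < A * t + C + 3) (hlook : Correct N t look) {m : ℕ} {s s' : ℕ × ℕ}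
    (hs : Valid N A C t s) (h : iter (step A C look) m s = some s') : Valid N A C t s' :=
  iter_induction (valid_step hN hlook) m s s' hs h

end

/-! ### The terms before the pattern -/

/-- The terms of `Bbar N` with indices from `N + 1` to `N + 69`: the pair `(a, b)` at the position
`i` stands for `Bbar N (N + 1 + i) = a * (N - 72) + b`. -/
def transient : List (ℕ × ℕ) :=
  [(0, 6), (1, 73), (1, 74), (1, 75), (0, 9), (1, 76), (1, 77), (1, 78), (0, 12), (1, 79),
   (1, 80), (1, 81), (0, 15), (1, 82), (1, 83), (0, 17), (1, 85), (0, 18), (1, 85), (1, 87),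
   (1, 88), (0, 22), (0, 21), (2, 155), (2, 149), (0, 9), (0, 18), (2, 164), (2, 167), (1, 81),
   (0, 22), (1, 102), (1, 107), (1, 85), (0, 27), (0, 36), (1, 109), (2, 154), (1, 76), (0, 39),
   (1, 110), (1, 116), (1, 80), (0, 42), (1, 112), (1, 119), (0, 16), (1, 111), (1, 119), (1, 99),
   (0, 40), (1, 111), (0, 55), (2, 168), (1, 88), (0, 46), (1, 121), (1, 132), (0, 25), (0, 38),
   (0, 58), (4, 339), (2, 158), (1, 76), (0, 61), (0, 71), (2, 207), (2, 146), (1, 70)]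

/-- Supplies the initial terms at the parameter `t`, where `N = t + 72`. -/
def lookInit (α β : ℕ) : Option ℕ := if α ≤ 1 ∧ β ≤ 72 then some (pack α β) else none

/-- The state after the terms up to the index `N + 69`, started with the three terms at `N - 2`,
`N - 1` and `N`. -/
def transientState : Option (ℕ × ℕ) :=
  iter (step 1 70 lookInit) 69 (73, (pack 1 70 * 2 ^ 40 + pack 1 71) * 2 ^ 40 + pack 1 72)

/-- Compares a state that ends at the index `N + 69` with the list `transient`. -/
def transientCheck : Option (ℕ × ℕ) → Bool
  | none => false
  | some (n, mem) => n == 142 && (List.range 69).all fun i =>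
      match transient[i]? with
      | none => false
      | some (a, b) => entry mem (68 - i) == pack a b && decide (b < 2 ^ 28)

lemma transientCheck_eq_true : transientCheck transientState = true := by
  decide +kernel

/-- The terms after the initial ones, from the symbolic run `transientState` with the parameter
`t = N - 72`. -/
lemma Bbar_transient {N i a b : ℕ} (hN : 72 ≤ N) (h : transient[i]? = some (a, b)) :
    Bbar N (N + 1 + i) = some ((a * (N - 72 : ℕ) + b : ℕ) : ℤ) := by
  obtain ⟨t, rfl⟩ := Nat.exists_eq_add_of_le hN
  have hi : i < 69 := (List.getElem?_eq_some_iff.1 h).1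
  have hcheck := transientCheck_eq_true
  rcases hs : transientState with _ | ⟨n, mem⟩
  · simp [hs, transientCheck] at hcheck
  simp only [hs, transientCheck, Bool.and_eq_true, beq_iff_eq, List.all_eq_true,
    List.mem_range] at hcheck
  obtain ⟨rfl, hcheck⟩ := hcheck
  specialize hcheck i hi
  simp only [h, Bool.and_eq_true, beq_iff_eq, decide_eq_true_eq] at hcheck
  have hlook : Correct (72 + t) t lookInit := by
    intro α β c hc
    unfold lookInit at hc
    split_ifs at hc with hαβ
    cases hc
    rw [val_pack (by omega)]
    have : α * t ≤ 1 * t := Nat.mul_le_mul_right _ hαβ.1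
    rw [← Nat.cast_mul, ← Nat.cast_add]
    exact Bbar_of_mem (by positivity) (by norm_cast; omega)
  have hinit : Valid (72 + t) 1 70 t
      (73, (pack 1 70 * 2 ^ 40 + pack 1 71) * 2 ^ 40 + pack 1 72) := by
    refine ⟨by norm_num, fun d hd => ?_⟩
    rw [Bbar_of_mem (by dsimp only at hd ⊢; push_cast; omega) (by dsimp only; push_cast; omega)]
    dsimp only at hd ⊢
    have hd : d < 3 := by omega
    interval_cases d <;> simp [entry, pack, val, slope, offset] <;> ring
  unfold transientState at hs
  have hv := valid_iter (by omega) hlook hinit hs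
  have := hv.2 (68 - i) (by dsimp only; omega)
  dsimp only at this
  rw [hcheck.1, val_pack hcheck.2] at this
  rw [show 72 + t - 72 = t by omega, ← this]
  exact congrArg _ (by omega)

/-! ### The pattern -/

/-- Up to the index `2 * N + nu N`, the initial terms that the positions `0`, `1` and `2` of the
pattern refer to exist; at the position `r` the largest one is `7 * k + r + 2`. -/
lemma add_two_le_of_le_nu {N i : ℕ} (h : (i : ℤ) ≤ N + nu N) (hi : i % 7 < 3) : i + 2 ≤ N := by
  have : N % 7 < 7 := Nat.mod_lt _ (by norm_num)
  unfold nu at h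
  interval_cases hN : N % 7 <;> simp only at h <;> omega

lemma nu_le (N : ℕ) : nu N ≤ 2 := by
  unfold nu; split <;> norm_num

lemma Bbar_congr {N : ℕ} {m n x y : ℤ} (h : Bbar N m = some x) (hm : m = n) (hx : x = y) :
    Bbar N n = some y := by
  rw [← hm, ← hx, h]

lemma Bbar_step_of_eq {N : ℕ} {n a b c p q r i j l x y z v : ℤ}
    (h1 : Bbar N p = some a) (h2 : Bbar N q = some b) (h3 : Bbar N r = some c)
    (hx : Bbar N i = some x) (hy : Bbar N j = some y) (hz : Bbar N l = some z)
    (hn : (N : ℤ) < n) (hpqr : p = n - 1 ∧ q = n - 2 ∧ r = n - 3) (hpos : 0 < a ∧ 0 < b ∧ 0 < c)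
    (hijl : i = n - a ∧ j = n - b ∧ l = n - c) (hv : x + y + z = v) : Bbar N n = some v := by
  obtain ⟨rfl, rfl, rfl⟩ := hpqr
  obtain ⟨rfl, rfl, rfl⟩ := hijl
  rw [← hv]
  exact Bbar_step hn h1 h2 h3 hpos.1 hpos.2.1 hpos.2.2 hx hy hz

/-- The pattern holds from the index `N + 67` to the index `2 * N + nu N`. The terms before
`N + 70` are known from `Bbar_transient`; the later ones follow by strong induction. -/
lemma Bbar_pattern {N : ℕ} (hN : 72 ≤ N) (k : ℕ) (r : Fin 7) (h1 : 67 ≤ 7 * k + r)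
    (h2 : ((7 * k + r : ℕ) : ℤ) ≤ N + nu N) :
    Bbar N (N + 7 * k + (r : ℕ)) = some (patternTerm N k r) := by
  obtain ⟨i, hi⟩ : ∃ i, i = 7 * k + r := ⟨_, rfl⟩
  induction i using Nat.strong_induction_on generalizing k r with | _ i ih => ?_
  have hnu := nu_le N
  have base : ∀ j : ℤ, 0 ≤ j → j ≤ N → Bbar N j = some j := fun j => Bbar_of_mem
  have zero : ∀ j : ℤ, j ≤ 0 → Bbar N j = some 0 := fun j => Bbar_of_nonpos
  rcases lt_or_ge i 70 with hi70 | hi70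
  · obtain rfl : k = 9 := by omega
    have hr : (r : ℕ) = 4 ∨ (r : ℕ) = 5 ∨ (r : ℕ) = 6 := by omega
    rcases hr with hr | hr | hr
    · obtain rfl : r = 4 := Fin.ext hr
      refine Bbar_congr (Bbar_transient (i := 66) hN rfl) (by norm_num; ring) ?_
      change _ = 2 * (N : ℤ) + 2 * (9 : ℕ) + 45
      push_cast [hN]; omega
    · obtain rfl : r = 5 := Fin.ext hr
      refine Bbar_congr (Bbar_transient (i := 67) hN rfl) (by norm_num; ring) ?_
      change _ = 2 * (N : ℤ) + (9 : ℕ) - 7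
      push_cast [hN]; omega
    · obtain rfl : r = 6 := Fin.ext hr
      refine Bbar_congr (Bbar_transient (i := 68) hN rfl) (by norm_num; ring) ?_
      change _ = (N : ℤ) - 2
      push_cast [hN]; omega
  obtain ⟨k, rfl⟩ : ∃ l, k = l + 1 := ⟨k - 1, by omega⟩
  have prev : ∀ (l : ℕ) (s : Fin 7), 67 ≤ 7 * l + s → 7 * l + s < i →
      Bbar N (N + 7 * l + (s : ℕ)) = some (patternTerm N l s) := fun l s hl hs =>
    ih _ hs l s hl (by omega) rfl
  clear ih
  have p0 : ∀ l : ℕ, 67 ≤ 7 * l → 7 * l < i → Bbar N (N + 7 * l) = some (7 * l + 2 : ℤ) :=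
    fun l h h' => by simpa [patternTerm] using prev l 0 h h'
  have p1 : ∀ l : ℕ, 67 ≤ 7 * l + 1 → 7 * l + 1 < i →
      Bbar N (N + 7 * l + 1) = some (N + 7 * l + 2 : ℤ) := fun l => prev l 1
  have p2 : ∀ l : ℕ, 67 ≤ 7 * l + 2 → 7 * l + 2 < i →
      Bbar N (N + 7 * l + 2) = some (N + 7 * l + 4 : ℤ) := fun l => prev l 2
  have p3 : ∀ l : ℕ, 67 ≤ 7 * l + 3 → 7 * l + 3 < i →
      Bbar N (N + 7 * l + 3) = some (7 : ℤ) := fun l => prev l 3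
  have p4 : ∀ l : ℕ, 67 ≤ 7 * l + 4 → 7 * l + 4 < i →
      Bbar N (N + 7 * l + 4) = some (2 * N + 2 * l + 45 : ℤ) := fun l => prev l 4
  have p5 : ∀ l : ℕ, 67 ≤ 7 * l + 5 → 7 * l + 5 < i →
      Bbar N (N + 7 * l + 5) = some (2 * N + l - 7 : ℤ) := fun l => prev l 5
  have p6 : ∀ l : ℕ, 67 ≤ 7 * l + 6 → 7 * l + 6 < i →
      Bbar N (N + 7 * l + 6) = some (N - 2 : ℤ) := fun l => prev l 6
  clear prev
  match r with
  | 0 =>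
    have hk := add_two_le_of_le_nu h2 (by simp)
    change i = 7 * (k + 1) + 0 at hi
    change Bbar N (N + 7 * (k + 1 : ℕ) + (0 : ℕ)) = some (7 * (k + 1 : ℕ) + 2 : ℤ)
    exact Bbar_step_of_eq (p6 k (by omega) (by omega)) (p5 k (by omega) (by omega))
      (p4 k (by omega) (by omega)) (base (7 * k + 9) (by omega) (by omega))
      (zero (N + 7 * k + 7 - (2 * N + k - 7)) (by omega))
      (zero (N + 7 * k + 7 - (2 * N + 2 * k + 45)) (by omega))
      (by omega) (by omega) (by omega) (by omega) (by omega)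
  | 1 =>
    have hk := add_two_le_of_le_nu h2 (by simp)
    change i = 7 * (k + 1) + 1 at hi
    change Bbar N (N + 7 * (k + 1 : ℕ) + (1 : ℕ)) = some (N + 7 * (k + 1 : ℕ) + 2 : ℤ)
    exact Bbar_step_of_eq (p0 (k + 1) (by omega) (by omega)) (p6 k (by omega) (by omega))
      (p5 k (by omega) (by omega)) (base (N - 1) (by omega) (by omega))
      (base (7 * k + 10) (by omega) (by omega))
      (zero (N + 7 * k + 8 - (2 * N + k - 7)) (by omega))
      (by omega) (by omega) (by omega) (by omega) (by omega)
  | 2 =>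
    have hk := add_two_le_of_le_nu h2 (by simp)
    change i = 7 * (k + 1) + 2 at hi
    change Bbar N (N + 7 * (k + 1 : ℕ) + (2 : ℕ)) = some (N + 7 * (k + 1 : ℕ) + 4 : ℤ)
    exact Bbar_step_of_eq (p1 (k + 1) (by omega) (by omega)) (p0 (k + 1) (by omega) (by omega))
      (p6 k (by omega) (by omega)) (zero 0 (by omega)) (base N (by omega) (by omega))
      (base (7 * k + 11) (by omega) (by omega))
      (by omega) (by omega) (by omega) (by omega) (by omega)
  | 3 =>
    change i = 7 * (k + 1) + 3 at hi
    change Bbar N (N + 7 * (k + 1 : ℕ) + (3 : ℕ)) = some (7 : ℤ)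
    exact Bbar_step_of_eq (p2 (k + 1) (by omega) (by omega)) (p1 (k + 1) (by omega) (by omega))
      (p0 (k + 1) (by omega) (by omega)) (zero (-1) (by omega)) (base 1 (by omega) (by omega))
      (Bbar_transient (i := 0) hN rfl)
      (by omega) (by omega) (by omega) (by omega) (by omega)
  | 4 =>
    change i = 7 * (k + 1) + 4 at hi
    change Bbar N (N + 7 * (k + 1 : ℕ) + (4 : ℕ)) = some (2 * N + 2 * (k + 1 : ℕ) + 45 : ℤ)
    exact Bbar_step_of_eq (p3 (k + 1) (by omega) (by omega)) (p2 (k + 1) (by omega) (by omega))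
      (p1 (k + 1) (by omega) (by omega)) (p4 k (by omega) (by omega)) (zero 0 (by omega))
      (base 2 (by omega) (by omega))
      (by omega) (by omega) (by omega) (by omega) (by omega)
  | 5 =>
    change i = 7 * (k + 1) + 5 at hi
    change Bbar N (N + 7 * (k + 1 : ℕ) + (5 : ℕ)) = some (2 * N + (k + 1 : ℕ) - 7 : ℤ)
    exact Bbar_step_of_eq (p4 (k + 1) (by omega) (by omega)) (p3 (k + 1) (by omega) (by omega))
      (p2 (k + 1) (by omega) (by omega))
      (zero (N + 7 * k + 12 - (2 * N + 2 * k + 47)) (by omega))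
      (p5 k (by omega) (by omega)) (base 1 (by omega) (by omega))
      (by omega) (by omega) (by omega) (by omega) (by omega)
  | 6 =>
    change i = 7 * (k + 1) + 6 at hi
    change Bbar N (N + 7 * (k + 1 : ℕ) + (6 : ℕ)) = some (N - 2 : ℤ)
    exact Bbar_step_of_eq (p5 (k + 1) (by omega) (by omega)) (p4 (k + 1) (by omega) (by omega))
      (p3 (k + 1) (by omega) (by omega))
      (zero (N + 7 * k + 13 - (2 * N + k - 6)) (by omega))
      (zero (N + 7 * k + 13 - (2 * N + 2 * k + 47)) (by omega)) (p6 k (by omega) (by omega))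
      (by omega) (by omega) (by omega) (by omega) (by omega)

/-! ### The terms after the pattern -/

/-- The code, as a function of `t`, of the term that the pattern prescribes at the index
`N + 7 * k + r`, where `N = 7 * t + M`, `k = s * t + o / 7` and `r = o % 7`. -/
def patternCode (M s o : ℕ) : ℕ :=
  match o % 7 with
  | 0 => pack (7 * s) (7 * (o / 7) + 2)
  | 1 => pack (7 + 7 * s) (M + 7 * (o / 7) + 2)
  | 2 => pack (7 + 7 * s) (M + 7 * (o / 7) + 4)
  | 3 => pack 0 7
  | 4 => pack (14 + 2 * s) (2 * M + 2 * (o / 7) + 45)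
  | 5 => pack (14 + s) (2 * M + o / 7 - 7)
  | _ => pack 7 (M - 2)

/-- Supplies the terms up to the end `N + K + 7 * t` of the pattern at the parameter `t`, where
`N = 7 * t + M`. -/
def lookPattern (M K α β : ℕ) : Option ℕ :=
  if α ≤ 7 ∧ β ≤ M then some (pack α β)
  else if β ≤ M then none
  else if α = 7 then
    if β ≤ M + 69 then
      transient[β - M - 1]?.map fun c => pack (7 * c.1) (c.1 * (M - 72) + c.2)
    else if β ≤ M + K then some (patternCode M 0 (β - M))
    else none
  else if α = 14 ∧ M + 67 ≤ β ∧ β ≤ M + K then some (patternCode M 1 (β - M))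
  else none

/-- The end of the pattern (`s = 1`) and its beginning (`s = 0`) as affine functions of `t`. -/
lemma Bbar_patternCode {N M s o t : ℕ} (hM : 72 ≤ M) (hM' : M < 10 ^ 6) (ho' : o < 10 ^ 7)
    (hN : N = 7 * t + M) (ho : 67 ≤ o) (hend : ((7 * (s * t) + o : ℕ) : ℤ) ≤ N + nu N) :
    Bbar N (N + 7 * (s * t) + o) = some (val (patternCode M s o) t : ℤ) := by
  obtain ⟨q, r, rfl⟩ : ∃ (q : ℕ) (r : Fin 7), o = 7 * q + r :=
    ⟨o / 7, ⟨o % 7, Nat.mod_lt _ (by norm_num)⟩, by dsimp only; omega⟩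
  have key := Bbar_pattern (N := N) (by omega) (s * t + q) r (by omega) (by push_cast at *; omega)
  refine Bbar_congr key (by push_cast; ring) ?_
  rw [patternCode, show (7 * q + r) % 7 = r by omega, show (7 * q + r) / 7 = q by omega]
  have hq : q < 10 ^ 7 := by omega
  clear key hend ho ho'
  fin_cases r <;> simp only <;> rw [val_pack (by omega)] <;> subst hN
  · change 7 * ((s * t + q : ℕ) : ℤ) + 2 = _
    push_cast; ring
  · change ((7 * t + M : ℕ) : ℤ) + 7 * ((s * t + q : ℕ) : ℤ) + 2 = _
    push_cast; ring
  · change ((7 * t + M : ℕ) : ℤ) + 7 * ((s * t + q : ℕ) : ℤ) + 4 = _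
    push_cast; ring
  · change (7 : ℤ) = _
    push_cast; ring
  · change 2 * ((7 * t + M : ℕ) : ℤ) + 2 * ((s * t + q : ℕ) : ℤ) + 45 = _
    push_cast; ring
  · change 2 * ((7 * t + M : ℕ) : ℤ) + ((s * t + q : ℕ) : ℤ) - 7 = _
    rw [Nat.cast_add _ (2 * M + q - 7), Nat.cast_sub (by omega)]
    push_cast; ring
  · change ((7 * t + M : ℕ) : ℤ) - 2 = _
    rw [Nat.cast_add _ (M - 2), Nat.cast_sub (by omega)]
    push_cast; ring

lemma transient_bound : ∀ c ∈ transient, c.1 ≤ 4 ∧ c.2 < 10 ^ 3 := by decide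

lemma correct_lookPattern {N M K t : ℕ} (hM : 72 ≤ M) (hM' : M < 10 ^ 6) (hN : N = 7 * t + M)
    (hK : (K : ℤ) = M + nu N) : Correct N t (lookPattern M K) := by
  have hnu := nu_le N
  intro α β c h
  unfold lookPattern at h
  split_ifs at h with h1 _ h3
  · cases h
    rw [val_pack (by omega)]
    have : α * t ≤ 7 * t := Nat.mul_le_mul_right _ h1.1
    rw [← Nat.cast_mul, ← Nat.cast_add]
    exact Bbar_of_mem (by positivity) (by norm_cast; omega)
  · obtain ⟨⟨a, b⟩, hab, rfl⟩ := Option.map_eq_some_iff.1 h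
    have hb := transient_bound _ (List.mem_of_getElem? hab)
    dsimp only at hb ⊢
    have : a * (M - 72) ≤ 4 * (M - 72) := Nat.mul_le_mul_right _ hb.1
    refine Bbar_congr (Bbar_transient (by omega) hab) (by subst h3; push_cast; omega) ?_
    rw [val_pack (by omega), hN, show 7 * t + M - 72 = 7 * t + (M - 72) by omega]
    push_cast; ring
  · cases h
    refine Bbar_congr (Bbar_patternCode (s := 0) hM hM' (o := β - M) ?_ hN ?_ ?_) ?_ rfl
    all_goals subst h3; push_cast; omega
  · cases h
    refine Bbar_congr (Bbar_patternCode (s := 1) hM hM' (o := β - M) ?_ hN ?_ ?_) ?_ rfl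
    all_goals obtain ⟨rfl, -⟩ := ‹α = 14 ∧ _›; push_cast; omega

/-- Runs the recurrence from the end `N + K + 7 * t` of the pattern, for all `N = 7 * t + M` at
once, and tests whether it arrives at a vanishing term at the index `2 * N + T`. The run may make
up to `70 * m` steps; the nested iteration keeps the recursion shallow. -/
def endCheck (M K T m : ℕ) : Bool :=
  match iter (iter (step 14 (M + K - 2) (lookPattern M K)) 70) m (M + K + 1,
    (patternCode M 1 (K - 2) * 2 ^ 40 + patternCode M 1 (K - 1)) * 2 ^ 40 + patternCode M 1 K) with
  | none => false
  | some (n, mem) => n == 2 * M + T + 1 && mem % 2 ^ 40 == 0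

/-- A successful run of `endCheck` at `M` proves the end of the sequence for all `N ≥ M` in the
residue class of `M`; `K` is such that `M + K` is the last index of the pattern in
`Bbar M`. -/
lemma endsAfter_of_endCheck {N M K T m : ℕ} (hM : 72 ≤ M) (hM' : M < 10 ^ 6) (hN : M ≤ N)
    (hmod : N ≡ M [MOD 7]) (hK : (K : ℤ) = M + nu M) (h : endCheck M K T m = true) :
    EndsAfter (Bbar N) (2 * (N : ℤ) + T) := by
  have hmod : N % 7 = M % 7 := hmod
  have hnu : nu M = nu N := by unfold nu; rw [hmod]
  obtain ⟨t, ht⟩ : ∃ t, N = 7 * t + M := ⟨(N - M) / 7, by omega⟩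
  rw [hnu] at hK
  have hle := nu_le N
  have hge : -2 ≤ nu N := by unfold nu; split <;> norm_num
  have hpattern : ∀ o, 67 ≤ o → o ≤ K →
      Bbar N (N + 7 * t + o) = some (val (patternCode M 1 o) t : ℤ) := fun o h1 h2 =>
    Bbar_congr (Bbar_patternCode (s := 1) hM hM' (by omega) ht h1 (by push_cast; omega))
      (by push_cast; ring) rfl
  have hsize : ∀ o < 10 ^ 7, patternCode M 1 o < 2 ^ 40 := by
    intro o ho
    unfold patternCode pack
    split <;> omega
  unfold endCheck at h
  split at h
  · exact absurd h (by simp)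
  rename_i n mem hs
  simp only [Bool.and_eq_true, beq_iff_eq] at h
  obtain ⟨rfl, hmem⟩ := h
  have hv : Valid N 14 (M + K - 2) t (2 * M + T + 1, mem) := by
    refine iter_induction (fun s s' => valid_iter (by omega) (correct_lookPattern hM hM' ht hK))
      m _ _ ⟨by dsimp only; omega, fun d hd => ?_⟩ hs
    dsimp only at hd ⊢
    have hd : d < 3 := by omega
    interval_cases d
    · rw [entry_push_zero (hsize K (by omega))]
      exact Bbar_congr (hpattern K (by omega) le_rfl) (by push_cast; omega) rfl
    · rw [entry_push_succ (hsize K (by omega)), entry_push_zero (hsize (K - 1) (by omega))]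
      exact Bbar_congr (hpattern (K - 1) (by omega) (by omega)) (by push_cast; omega) rfl
    · rw [entry_push_succ (hsize K (by omega)), entry_push_succ (hsize (K - 1) (by omega)),
        show entry (patternCode M 1 (K - 2)) 0 = patternCode M 1 (K - 2) from
          Nat.mod_eq_of_lt (hsize (K - 2) (by omega))]
      exact Bbar_congr (hpattern (K - 2) (by omega) (by omega)) (by push_cast; omega) rfl
  obtain ⟨hv1, hv2⟩ := hv
  dsimp only at hv1 hv2
  have hlast : Bbar N (2 * N + T) = some 0 := by
    refine Bbar_congr (hv2 0 (by omega)) (by push_cast; omega) ?_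
    rw [show entry mem 0 = 0 by simpa [entry] using hmem]
    simp [val, slope, offset]
  refine ⟨fun n hn => ?_, ⟨0, le_rfl, hlast⟩, fun n hn => Bbar_eq_none (by omega) hlast le_rfl hn⟩
  rcases le_or_gt n N with h1 | h1
  · simp [Bbar_of_le h1]
  obtain ⟨i, rfl⟩ : ∃ i : ℕ, n = N + 1 + i := ⟨(n - N - 1).toNat, by omega⟩
  rcases lt_or_ge i 69 with h2 | h2
  · rw [Bbar_transient (by omega) (List.getElem?_eq_getElem (l := transient) h2)]
    rfl
  rcases le_or_gt ((i : ℤ) + 1) (N + nu N) with h3 | h3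
  · rw [Bbar_congr (Bbar_pattern (N := N) (by omega) ((i + 1) / 7)
      ⟨(i + 1) % 7, Nat.mod_lt _ (by norm_num)⟩ (by dsimp only; omega) (by dsimp only; omega))
      (n := N + 1 + i) (by dsimp only; omega) rfl]
    rfl
  · have := hv2 (N + T - 1 - i) (by omega)
    rw [Bbar_congr this (n := N + 1 + i) (by omega) rfl]
    rfl

/-! ### The ends of the pattern -/

lemma followsPatternAt_iff {N : ℕ} {k : ℤ} (hk : 1 ≤ k) (r : Fin 7) :
    FollowsPatternAt N (N + 7 * k + (r : ℕ)) ↔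
      Bbar N (N + 7 * k + (r : ℕ)) = some (patternTerm N k r) := by
  refine ⟨fun ⟨k', _, r', h, hB⟩ => ?_, fun h => ⟨k, hk, r, rfl, h⟩⟩
  obtain rfl : k = k' := by omega
  obtain rfl : r = r' := Fin.ext (by omega)
  exact hB

/-- In each residue class, the first term after the pattern refers to the index that would have to
hold the summand `7 * k + 2`, `7 * k + 3` or `7 * k + 4`, but this index lies in the range
from `N + 1` to `N + 5`, where the terms are smaller than their indices. -/
lemma not_followsPatternAt_nu_add_one {N : ℕ} (hN : 72 ≤ N) :
    ¬ FollowsPatternAt N (2 * (N : ℤ) + nu N + 1) := by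
  have base : ∀ j : ℤ, 0 ≤ j → j ≤ N → Bbar N j = some j := fun j => Bbar_of_mem
  have zero : ∀ j : ℤ, j ≤ 0 → Bbar N j = some 0 := fun j => Bbar_of_nonpos
  have t1 := Bbar_transient (i := 0) hN rfl
  have t2 := Bbar_transient (i := 1) hN rfl
  have t3 := Bbar_transient (i := 2) hN rfl
  have t4 := Bbar_transient (i := 3) hN rfl
  have t5 := Bbar_transient (i := 4) hN rfl
  obtain ⟨m, r, hr, hm⟩ : ∃ m r, r < 7 ∧ N = 7 * m + r :=
    ⟨N / 7, N % 7, Nat.mod_lt _ (by norm_num), by omega⟩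
  have hmod : N % 7 = r := by omega
  have p0 : 67 ≤ 7 * m → ((7 * m : ℕ) : ℤ) ≤ N + nu N →
      Bbar N (N + 7 * m) = some (7 * m + 2 : ℤ) := fun h h' => by
    simpa [patternTerm] using Bbar_pattern hN m 0 h h'
  have p1 : 67 ≤ 7 * m + 1 → ((7 * m + 1 : ℕ) : ℤ) ≤ N + nu N →
      Bbar N (N + 7 * m + 1) = some (N + 7 * m + 2 : ℤ) := Bbar_pattern hN m 1
  have p4 : ∀ l, 67 ≤ 7 * l + 4 → ((7 * l + 4 : ℕ) : ℤ) ≤ N + nu N →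
      Bbar N (N + 7 * l + 4) = some (2 * N + 2 * l + 45 : ℤ) := fun l => Bbar_pattern hN l 4
  have p5 : ∀ l, 67 ≤ 7 * l + 5 → ((7 * l + 5 : ℕ) : ℤ) ≤ N + nu N →
      Bbar N (N + 7 * l + 5) = some (2 * N + l - 7 : ℤ) := fun l => Bbar_pattern hN l 5
  have p6 : ∀ l, 67 ≤ 7 * l + 6 → ((7 * l + 6 : ℕ) : ℤ) ≤ N + nu N →
      Bbar N (N + 7 * l + 6) = some (N - 2 : ℤ) := fun l => Bbar_pattern hN l 6
  -- In the classes other than 2 and 3, the pattern breaks at an index `N + 7 * l + 7`: the term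
  -- there is the one at `7 * l + 9`, which exceeds `N`.
  have stop0 : ∀ (l : ℕ) (x n : ℤ), 9 ≤ l → 7 * (l : ℤ) + 6 = N + nu N →
      Bbar N (7 * l + 9) = some x → x ≠ 7 * l + 9 → n = N + 7 * l + 7 →
      ¬ FollowsPatternAt N n := by
    rintro l x n hl hlast hx hne rfl hf
    have hval : Bbar N (N + 7 * l + 7) = some x :=
      Bbar_step_of_eq (p6 l (by omega) (by omega)) (p5 l (by omega) (by omega))
        (p4 l (by omega) (by omega)) hx
        (zero (N + 7 * l + 7 - (2 * N + l - 7)) (by have := nu_le N; omega))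
        (zero (N + 7 * l + 7 - (2 * N + 2 * l + 45)) (by have := nu_le N; omega))
        (by omega) (by omega) (by omega) (by omega) (by omega)
    have h := (followsPatternAt_iff (k := l + 1) (by omega) 0).1
      (by convert hf using 1; simp; ring)
    change Bbar N (N + 7 * (l + 1 : ℤ) + (0 : ℕ)) = some (7 * (l + 1 : ℤ) + 2) at h
    rw [Bbar_congr hval (by push_cast; ring) rfl, Option.some_inj] at h
    omega
  obtain ⟨l, rfl⟩ : ∃ l, m = l + 1 := ⟨m - 1, by omega⟩
  unfold nu at *
  rw [hmod] at *
  interval_cases r <;> simp only at *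
  · exact stop0 l (N + 1) _ (by omega) (by omega) (Bbar_congr t2 (by omega) (by omega)) (by omega)
      (by omega)
  · exact stop0 l 6 _ (by omega) (by omega) (Bbar_congr t1 (by omega) (by omega)) (by omega)
      (by omega)
  · intro hf
    have hval : Bbar N (N + 7 * (l + 1 : ℕ) + 1) = some (N + 5 : ℤ) :=
      Bbar_step_of_eq (p0 (by omega) (by omega)) (p6 l (by omega) (by omega))
        (p5 l (by omega) (by omega)) (base (N - 1) (by omega) (by omega)) t1
        (zero (N + 7 * l + 8 - (2 * N + l - 7)) (by omega))
        (by omega) (by omega) (by omega) (by omega) (by omega)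
    have h := (followsPatternAt_iff (k := (l + 1 : ℕ)) (by omega) 1).1
      (by convert hf using 1; simp; omega)
    change Bbar N (N + 7 * ((l + 1 : ℕ) : ℤ) + 1) = some (N + 7 * ((l + 1 : ℕ) : ℤ) + 2) at h
    rw [hval, Option.some_inj] at h
    omega
  · intro hf
    have hval : Bbar N (N + 7 * (l + 1 : ℕ) + 2) = some (N + 6 : ℤ) :=
      Bbar_step_of_eq (p1 (by omega) (by omega)) (p0 (by omega) (by omega))
        (p6 l (by omega) (by omega)) (zero 0 (by omega)) (base N (by omega) (by omega)) t1
        (by omega) (by omega) (by omega) (by omega) (by omega)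
    have h := (followsPatternAt_iff (k := (l + 1 : ℕ)) (by omega) 2).1
      (by convert hf using 1; simp; omega)
    change Bbar N (N + 7 * ((l + 1 : ℕ) : ℤ) + 2) = some (N + 7 * ((l + 1 : ℕ) : ℤ) + 4) at h
    rw [hval, Option.some_inj] at h
    omega
  · exact stop0 (l + 1) 9 _ (by omega) (by omega) (Bbar_congr t5 (by omega) (by omega)) (by omega)
      (by omega)
  · exact stop0 (l + 1) (N + 3) _ (by omega) (by omega) (Bbar_congr t4 (by omega) (by omega))
      (by omega) (by omega)
  · exact stop0 (l + 1) (N + 2) _ (by omega) (by omega) (Bbar_congr t3 (by omega) (by omega))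
      (by omega) (by omega)

lemma not_followsPatternAt_66 {N : ℕ} (hN : 72 ≤ N) : ¬ FollowsPatternAt N (N + 66) := by
  intro hf
  have h := (followsPatternAt_iff (k := 9) (by omega) 3).1 hf
  change Bbar N (N + 7 * 9 + 3) = some 7 at h
  have h' := Bbar_transient (i := 65) hN rfl
  rw [Bbar_congr h' (n := N + 7 * 9 + 3) (by push_cast; ring) rfl] at h
  simp at h

end HofstadterB

theorem theorem2 (N : ℕ) (hN : 72 ≤ N) :
    -- the pattern begins at the index `N + 67` and lasts through the index `2 * N + ν`
    (∀ n : ℤ, (N : ℤ) + 67 ≤ n → n ≤ 2 * (N : ℤ) + HofstadterB.nu N →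
      HofstadterB.FollowsPatternAt N n) ∧
    ¬ HofstadterB.FollowsPatternAt N ((N : ℤ) + 66) ∧
    ¬ HofstadterB.FollowsPatternAt N (2 * (N : ℤ) + HofstadterB.nu N + 1) ∧
    -- the end of the sequence
    (N ≡ 0 [MOD 7] → 196 ≤ N → HofstadterB.EndsAfter (HofstadterB.Bbar N) (2 * (N : ℤ) + 27)) ∧
    (N ≡ 1 [MOD 7] → 2087 ≤ N → HofstadterB.EndsAfter (HofstadterB.Bbar N) (2 * (N : ℤ) + 254)) ∧
    (N ≡ 2 [MOD 7] → 3201 ≤ N → HofstadterB.EndsAfter (HofstadterB.Bbar N) (2 * (N : ℤ) + 524)) ∧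
    (N ≡ 3 [MOD 7] → 4315 ≤ N → HofstadterB.EndsAfter (HofstadterB.Bbar N) (2 * (N : ℤ) + 560)) ∧
    (N ≡ 4 [MOD 7] → 200 ≤ N → HofstadterB.EndsAfter (HofstadterB.Bbar N) (2 * (N : ℤ) + 20)) ∧
    (N ≡ 5 [MOD 7] → 32478 ≤ N →
      HofstadterB.EndsAfter (HofstadterB.Bbar N) (2 * (N : ℤ) + 4547)) ∧
    (N ≡ 6 [MOD 7] → 118 ≤ N → HofstadterB.EndsAfter (HofstadterB.Bbar N) (2 * (N : ℤ) + 9)) := by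
  open HofstadterB in
  refine ⟨fun n h1 h2 => ?_, not_followsPatternAt_66 hN, not_followsPatternAt_nu_add_one hN,
    fun hr h => ?_, fun hr h => ?_, fun hr h => ?_, fun hr h => ?_, fun hr h => ?_,
    fun hr h => ?_, fun hr h => ?_⟩
  · obtain ⟨i, rfl⟩ : ∃ i : ℕ, n = N + i := ⟨(n - N).toNat, by omega⟩
    have h := Bbar_pattern hN (i / 7) ⟨i % 7, Nat.mod_lt _ (by norm_num)⟩
      (by dsimp only; omega) (by dsimp only; omega)
    exact ⟨(i / 7 : ℕ), by omega, ⟨i % 7, Nat.mod_lt _ (by norm_num)⟩, by dsimp only; omega,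
      Bbar_congr h (by dsimp only; omega) rfl⟩
  · exact endsAfter_of_endCheck (M := 196) (K := 195) (T := 27) (m := 1) (by norm_num)
      (by norm_num) h hr (by norm_num [nu]) (by decide +kernel)
  · exact endsAfter_of_endCheck (M := 2087) (K := 2085) (T := 254) (m := 4) (by norm_num)
      (by norm_num) h hr (by norm_num [nu]) (by decide +kernel)
  · exact endsAfter_of_endCheck (M := 3201) (K := 3199) (T := 524) (m := 8) (by norm_num)
      (by norm_num) h hr (by norm_num [nu]) (by decide +kernel)
  · exact endsAfter_of_endCheck (M := 4315) (K := 4313) (T := 560) (m := 9) (by norm_num)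
      (by norm_num) h hr (by norm_num [nu]) (by decide +kernel)
  · exact endsAfter_of_endCheck (M := 200) (K := 202) (T := 20) (m := 1) (by norm_num)
      (by norm_num) h hr (by norm_num [nu]) (by decide +kernel)
  · exact endsAfter_of_endCheck (M := 32478) (K := 32479) (T := 4547) (m := 65) (by norm_num)
      (by norm_num) h hr (by norm_num [nu]) (by decide +kernel)
  · exact endsAfter_of_endCheck (M := 118) (K := 118) (T := 9) (m := 1) (by norm_num)
      (by norm_num) h hr (by norm_num [nu]) (by decide +kernel)
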